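/- Let $K$ be a field, $N, M\ge 0$ integers, and for $i=1,\dots,N$ let $a_1^{(i)},a_2^{(i)},b_1^{(i)},b_2^{(i)},c_1^{(i)},c_2^{(i)}\in K$ satisfy the free fermion condition $a_1^{(i)}a_2^{(i)}+b_1^{(i)}b_2^{(i)}=c_1^{(i)}c_2^{(i)}$ and $a_1^{(i)}\neq 0$. Consider the six-vertex model on a grid with $N$ rows, numbered $1,\dots,N$ from bottom to top, and $M+1$ columns, numbered $0,\dots,M$ from left to right. Edges carry spins $\pm$. A vertex in row $i$ whose spins on the (left, top, right, bottom) edges are $(+,+,+,+)$, $(-,-,-,-)$, $(+,-,+,-)$, $(-,+,-,+)$, $(-,+,+,-)$, $(+,-,-,+)$ has weight $a_1^{(i)},a_2^{(i)},b_1^{(i)},b_2^{(i)},c_1^{(i)},c_2^{(i)}$ respectively; every other vertex has weight $0$. The weight of a state (an assignment of spins to all edges) is the product of the weights of its vertices. Let $\lambda=(\lambda_1\ge\dots\ge\lambda_N\ge 0)$ be a partition such that all parts of the strict partition $\lambda+\rho=(\lambda_1+N-1,\lambda_2+N-2,\dots,\lambda_N)$ are at most $M$. Let $Z_\lambda$ be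 the sum of the weights of all states with domain-wall boundary conditions: all right boundary edges are $-$, all left and all bottom boundary edges are $+$, and the top boundary edge in column $j$ is $-$ if $j$ is a part of $\lambda+\rho$ and $+$ otherwise. Let $\tau$ be the complement of $\lambda$ in an $N\times(M+1-N)$ box, rotated by $180^\circ$, i.e. $\tau_k=M+1-N-\lambda_{N+1-k}$ for $1\le k\le N$. Then $$Z_\lambda=\prod_{i=1}^N (a_1^{(i)})^{M+1-N}c_2^{(i)}\cdot\prod_{1\le j<i\le N}\left(a_1^{(j)}a_2^{(i)}+b_1^{(i)}b_2^{(j)}\right)\cdot s_\tau\!\left[\frac{b_2^{(1)}}{a_1^{(1)}},\dots,\frac{b_2^{(N)}}{a_1^{(N)}}\right],$$ where $s_\tau[x_1,\dots,x_N]$ is the Schur polynomial, i.e. the polynomial $\det\big(x_i^{\tau_j+N-j}\big)_{i,j}\big/\det\big(x_i^{N-j}\big)_{i,j}$. -/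

import Mathlib

/-- The two spins on an edge: `minus` marks a particle, `plus` its absence. -/
inductive Spin : Type
  | plus : Spin
  | minus : Spin
deriving DecidableEq

instance : Fintype Spin where
  elems := {.plus, .minus}
  complete := by intro s; cases s <;> simp

/-- The Boltzmann weights of the six admissible vertices of one row. -/
structure SixVertexWeights (K : Type*) where
  a₁ : K
  a₂ : K
  b₁ : K
  b₂ : K
  c₁ : K
  c₂ : K

namespace SixVertexWeights

/-- The free fermion condition. -/
def FreeFermionic {K : Type*} [CommRing K] (w : SixVertexWeights K) : Prop :=
  w.a₁ * w.a₂ + w.b₁ * w.b₂ = w.c₁ * w.c₂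

/-- The weight of a vertex, given the spins on its left, top, right and bottom edges.
Following the `minus` spins, paths move up and left. Non-admissible vertices have weight `0`. -/
def vertexWeight {K : Type*} [CommRing K] (w : SixVertexWeights K) :
    (left top right bottom : Spin) → K
  | .plus, .plus, .plus, .plus => w.a₁
  | .minus, .minus, .minus, .minus => w.a₂
  | .plus, .minus, .plus, .minus => w.b₁
  | .minus, .plus, .minus, .plus => w.b₂
  | .minus, .plus, .plus, .minus => w.c₁
  | .plus, .minus, .minus, .plus => w.c₂
  | _, _, _, _ => 0

end SixVertexWeights

/-- An assignment of spins to all the edges of a grid with `N` rows (numbered from bottom to top)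
and `C` columns (numbered from left to right). The edge `hor i j` is in row `i`, immediately to the
left of column `j` (or right of the last column, for `j = C`); the edge `ver i j` is in column `j`,
immediately below row `i` (or above the last row, for `i = N`). -/
abbrev LatticeState (N C : ℕ) : Type :=
  (Fin N → Fin (C + 1) → Spin) × (Fin (N + 1) → Fin C → Spin)

namespace LatticeState

variable {N C : ℕ}

/-- The spin on a horizontal edge. -/
def hor (s : LatticeState N C) (i : Fin N) (j : Fin (C + 1)) : Spin := s.1 i j

/-- The spin on a vertical edge. -/
def ver (s : LatticeState N C) (i : Fin (N + 1)) (j : Fin C) : Spin := s.2 i j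

/-- The state `s` has the prescribed spins on the boundary edges. -/
def HasBoundary (s : LatticeState N C) (left right : Fin N → Spin) (bottom top : Fin C → Spin) :
    Prop :=
  (∀ i, s.hor i 0 = left i) ∧ (∀ i, s.hor i (Fin.last C) = right i) ∧
    (∀ j, s.ver 0 j = bottom j) ∧ (∀ j, s.ver (Fin.last N) j = top j)

/-- The Boltzmann weight of a state: the product of the weights of its vertices. -/
def weight {K : Type*} [CommRing K] (w : Fin N → SixVertexWeights K) (s : LatticeState N C) : K :=
  ∏ i : Fin N, ∏ j : Fin C,
    (w i).vertexWeight (s.hor i j.castSucc) (s.ver i.succ j) (s.hor i j.succ) (s.ver i.castSucc j)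

end LatticeState

open Classical in
/-- The partition function of the six-vertex model with row weights `w` and prescribed boundary
spins: the sum of the weights of all states (non-admissible states have weight `0`). -/
noncomputable def partitionFunction {K : Type*} [CommRing K] {N C : ℕ}
    (w : Fin N → SixVertexWeights K) (left right : Fin N → Spin) (bottom top : Fin C → Spin) : K :=
  ∑ s : LatticeState N C with s.HasBoundary left right bottom top, s.weight w

/-- The shift `lam + ρ`, where `ρ = (N - 1, …, 1, 0)`. -/
def shiftRho {N : ℕ} (lam : Fin N → ℕ) (k : Fin N) : ℕ := lam k + (k.rev : ℕ)

open Classical in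
/-- Boundary spins that are `minus` exactly in the columns (numbered from `0`) that are parts of the
strict partition `p`. -/
noncomputable def boundarySpin {N C : ℕ} (p : Fin N → ℕ) (j : Fin C) : Spin :=
  if ∃ k, p k = (j : ℕ) then .minus else .plus

/-- The partition function `Z_lam` with domain-wall boundary conditions: columns `0, …, M`, right
edges `minus`, left and bottom edges `plus`, top edges `minus` on the parts of `lam + ρ`. -/
noncomputable def domainWallZ {K : Type*} [CommRing K] {N : ℕ} (M : ℕ)
    (w : Fin N → SixVertexWeights K) (lam : Fin N → ℕ) : K :=
  partitionFunction (C := M + 1) w (fun _ => .plus) (fun _ => .minus) (fun _ => .plus)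
    (boundarySpin (shiftRho lam))

/-- The complement of `lam` in a box with `N` rows of length `L`, rotated by 180 degrees. -/
def boxComplement {N : ℕ} (L : ℕ) (lam : Fin N → ℕ) (k : Fin N) : ℕ := L - lam k.rev

/-- The alternant `det (X_i ^ m_j)`. -/
noncomputable def alternant {N : ℕ} (m : Fin N → ℕ) : MvPolynomial (Fin N) ℤ :=
  (Matrix.of fun i j : Fin N => (MvPolynomial.X i : MvPolynomial (Fin N) ℤ) ^ m j).det

/-- The alternant of `ρ` divides every alternant. -/
theorem alternant_dvd {N : ℕ} (m : Fin N → ℕ) :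
    alternant (shiftRho fun _ : Fin N => 0) ∣ alternant m := by
  classical
  set P : Polynomial (MvPolynomial (Fin N) ℤ) :=
    ∏ i : Fin N, (Polynomial.X - Polynomial.C (MvPolynomial.X i)) with hP
  have hmon : P.Monic := Polynomial.monic_prod_of_monic _ _ fun i _ => Polynomial.monic_X_sub_C _
  have hroot : ∀ i : Fin N, P.eval (MvPolynomial.X i) = 0 := by
    intro i
    rw [hP, Polynomial.eval_prod]
    exact Finset.prod_eq_zero (Finset.mem_univ i) (by simp)
  have hdeg : P.natDegree = N := by
    rw [hP, Polynomial.natDegree_prod_of_monic _ _ fun i _ => Polynomial.monic_X_sub_C _]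
    simp
  have hlt : ∀ (_ : Fin N) (k : ℕ), (Polynomial.X ^ k %ₘ P).natDegree < N := by
    intro i k
    have h1 : P ≠ 1 := by
      intro h
      have := i.pos
      rw [h, Polynomial.natDegree_one] at hdeg
      omega
    have h := Polynomial.natDegree_modByMonic_lt (Polynomial.X ^ k) hmon h1
    rwa [hdeg] at h
  have key : (Matrix.of fun i j : Fin N => (MvPolynomial.X i : MvPolynomial (Fin N) ℤ) ^ m j) =
      (Matrix.of fun i j : Fin N =>
        (MvPolynomial.X i : MvPolynomial (Fin N) ℤ) ^ shiftRho (fun _ : Fin N => 0) j) *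
      (Matrix.of fun l j : Fin N => (Polynomial.X ^ m j %ₘ P).coeff (l.rev : ℕ)) := by
    ext1 i j
    have h1 : (Polynomial.X ^ m j %ₘ P).eval (MvPolynomial.X i) =
        (MvPolynomial.X i : MvPolynomial (Fin N) ℤ) ^ m j := by
      have h := congrArg (Polynomial.eval (MvPolynomial.X i))
        (Polynomial.modByMonic_add_div (Polynomial.X ^ m j) P)
      simpa [hroot i] using h
    rw [Matrix.mul_apply, Matrix.of_apply, ← h1,
      Polynomial.eval_eq_sum_range' (hlt i _),
      ← Fin.sum_univ_eq_sum_range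
        (fun l => (Polynomial.X ^ m j %ₘ P).coeff l * (MvPolynomial.X i) ^ l) N,
      ← Equiv.sum_comp Fin.revPerm]
    refine Finset.sum_congr rfl fun l _ => ?_
    simp [shiftRho, mul_comm]
  unfold alternant
  rw [key, Matrix.det_mul]
  exact dvd_mul_right _ _

/-- The Schur polynomial `s_tau = A_{tau + ρ} / A_ρ` in `N` variables. -/
noncomputable def schurPoly {N : ℕ} (tau : Fin N → ℕ) : MvPolynomial (Fin N) ℤ :=
  (alternant_dvd (shiftRho tau)).choose

theorem alternant_rho_mul_schurPoly {N : ℕ} (tau : Fin N → ℕ) :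
    alternant (shiftRho fun _ : Fin N => 0) * schurPoly tau = alternant (shiftRho tau) :=
  (alternant_dvd (shiftRho tau)).choose_spec.symm

/-!
Encode a row of vertical spins by the exterior product of the monomials `X ^ k` over the columns `k`
(counted from the right) with spin `minus`. Write `b₂ = a₁ x` in a row. By the free fermion
condition, the transfer matrix of the row is then the interior product with evaluation at `x`, up to
the multiplication operators by `x - X` and by `a₂ + b₁ X`. Pairing with evaluations at
`x₁, …, x_N` turns these operators into scalars, so the partition function times the difference
product of the `x i` is the alternant of the columns with top spin `minus`, times an explicit
product of row weights. The difference product can be cancelled when it is regular, and the general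
case is the specialization `t = 0` of the deformation `x i + t ^ (i + 1)`, whose differences are
monic in `t` up to sign.
-/

open CliffordAlgebra (contractLeft contractLeft_ι_mul contractLeft_one)
open ExteriorAlgebra (ι ιMulti)
open Polynomial (X leval)

section WedgePairing

variable {R V : Type*} [CommRing R] [AddCommGroup V] [Module R V]

/-- The pairing of `d 0 ∧ ⋯ ∧ d (n - 1)` with the exterior algebra: the determinant of the matrix
`d i (v j)` on a product of `n` vectors `v j`, and zero in all degrees other than `n`. -/
noncomputable def wedgePairing {n : ℕ} (d : Fin n → Module.Dual R V) :
    ExteriorAlgebra R V →ₗ[R] R :=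
  ExteriorAlgebra.liftAlternating
    (Pi.single n (Matrix.detRowAlternating.compLinearMap (LinearMap.pi d)))

theorem wedgePairing_ιMulti {n : ℕ} (d : Fin n → Module.Dual R V) (v : Fin n → V) :
    wedgePairing d (ιMulti R n v) = (Matrix.of fun i j => d i (v j)).det := by
  rw [wedgePairing, ExteriorAlgebra.liftAlternating_apply_ιMulti, Pi.single_eq_same,
    ← Matrix.det_transpose]
  rfl

theorem wedgePairing_ιMulti_of_ne {m n : ℕ} (h : m ≠ n) (d : Fin n → Module.Dual R V)
    (v : Fin m → V) : wedgePairing d (ιMulti R m v) = 0 := by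
  rw [wedgePairing, ExteriorAlgebra.liftAlternating_apply_ιMulti, Pi.single_eq_of_ne h,
    AlternatingMap.zero_apply]

theorem wedgePairing_map {W : Type*} [AddCommGroup W] [Module R W] {n : ℕ}
    (d : Fin n → Module.Dual R W) (f : V →ₗ[R] W) (y : ExteriorAlgebra R V) :
    wedgePairing d (ExteriorAlgebra.map f y) = wedgePairing (fun i => d i ∘ₗ f) y := by
  suffices wedgePairing d ∘ₗ (ExteriorAlgebra.map f).toLinearMap =
      wedgePairing fun i => d i ∘ₗ f from LinearMap.congr_fun this y
  ext m v
  obtain rfl | h := eq_or_ne m n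
  · simp [ExteriorAlgebra.map_apply_ιMulti, wedgePairing_ιMulti]
  · simp [ExteriorAlgebra.map_apply_ιMulti, wedgePairing_ιMulti_of_ne h]

theorem wedgePairing_smul {n : ℕ} (c : Fin n → R) (d : Fin n → Module.Dual R V) :
    wedgePairing (fun i => c i • d i) = (∏ i, c i) • wedgePairing d := by
  ext m v
  obtain rfl | h := eq_or_ne m n
  · simpa [wedgePairing_ιMulti] using Matrix.det_mul_column c (Matrix.of fun i j => d i (v j))
  · simp [wedgePairing_ιMulti_of_ne h]

theorem contractLeft_ιMulti (d : Module.Dual R V) {n : ℕ} (v : Fin (n + 1) → V) :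
    contractLeft d (ιMulti R (n + 1) v) =
      ∑ j : Fin (n + 1), ((-1) ^ (j : ℕ) * d (v j)) • ιMulti R n (v ∘ j.succAbove) := by
  induction n with
  | zero =>
    rw [ExteriorAlgebra.ιMulti_succ_apply, contractLeft_ι_mul]
    simp [contractLeft_one]
  | succ n ih =>
    rw [ExteriorAlgebra.ιMulti_succ_apply, contractLeft_ι_mul, ih,
      Fin.sum_univ_succ (n := n + 1), Finset.mul_sum, sub_eq_add_neg, ← Finset.sum_neg_distrib]
    congr 1
    · rw [Fin.val_zero, pow_zero, one_mul, Fin.succAbove_zero]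
      rfl
    · refine Finset.sum_congr rfl fun j _ => ?_
      have h_tail : Matrix.vecTail (v ∘ j.succ.succAbove) = Matrix.vecTail v ∘ j.succAbove := by
        ext k
        simp [Matrix.vecTail]
      rw [ExteriorAlgebra.ιMulti_succ_apply (v ∘ j.succ.succAbove), h_tail]
      simp [Matrix.vecTail, pow_succ]

theorem wedgePairing_succ {n : ℕ} (d : Fin (n + 1) → Module.Dual R V) (y : ExteriorAlgebra R V) :
    wedgePairing d y =
      (-1) ^ n * wedgePairing (Fin.init d) (contractLeft (d (Fin.last n)) y) := by
  suffices wedgePairing d = ((-1) ^ n : R) •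
      wedgePairing (Fin.init d) ∘ₗ contractLeft (d (Fin.last n)) from LinearMap.congr_fun this y
  ext m v
  simp only [LinearMap.compAlternatingMap_apply, LinearMap.smul_apply, LinearMap.comp_apply]
  cases m with
  | zero =>
    rw [wedgePairing_ιMulti_of_ne n.succ_ne_zero.symm, ExteriorAlgebra.ιMulti_zero_apply,
      contractLeft_one, map_zero, smul_zero]
  | succ m =>
    rw [contractLeft_ιMulti, map_sum]
    simp only [map_smul, smul_eq_mul]
    obtain rfl | h := eq_or_ne m n
    · simp only [wedgePairing_ιMulti]
      rw [Matrix.det_succ_row _ (Fin.last m), Finset.mul_sum]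
      refine Finset.sum_congr rfl fun j _ => ?_
      simp only [Fin.val_last, pow_add, Fin.succAbove_last, Matrix.of_apply, mul_assoc]
      rfl
    · rw [wedgePairing_ιMulti_of_ne (Nat.succ_ne_succ_iff.2 h)]
      simp [wedgePairing_ιMulti_of_ne h]

end WedgePairing

section FreeFermion

variable {R : Type*} [CommRing R]

/-- The endomorphism of the exterior algebra of `R[X]` that multiplies every vector by `f`. -/
noncomputable def mulMap (f : Polynomial R) :
    ExteriorAlgebra R (Polynomial R) →ₐ[R] ExteriorAlgebra R (Polynomial R) :=
  ExteriorAlgebra.map (LinearMap.mulLeft R f)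

theorem mulMap_ι (f g : Polynomial R) : mulMap f (ι R g) = ι R (f * g) := by
  rw [mulMap, ExteriorAlgebra.map_apply_ι, LinearMap.mulLeft_apply]

theorem wedgePairing_leval_mulMap {n : ℕ} (x : Fin n → R) (f : Polynomial R)
    (y : ExteriorAlgebra R (Polynomial R)) :
    wedgePairing (fun i => leval (x i)) (mulMap f y) =
      (∏ i, f.eval (x i)) * wedgePairing (fun i => leval (x i)) y := by
  have h (i : Fin n) : leval (x i) ∘ₗ LinearMap.mulLeft R f = f.eval (x i) • leval (x i) := by
    ext
    simp
  simp_rw [mulMap, wedgePairing_map, h, wedgePairing_smul, LinearMap.smul_apply, smul_eq_mul]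

theorem Spin.sum_univ {A : Type*} [AddCommMonoid A] (f : Spin → A) :
    ∑ s, f s = f .plus + f .minus :=
  Finset.sum_pair (by decide)

section SpinWedge

/-- The exterior product, from left to right, of the powers of `X` given by the columns with spin
`minus`; the exponent of a column is its distance to the last column. -/
noncomputable def spinWedge (R : Type*) [CommRing R] {C : ℕ} (v : Fin C → Spin) :
    ExteriorAlgebra R (Polynomial R) :=
  (((List.finRange C).filter fun j => v j = .minus).map fun j => ι R (X ^ (j.rev : ℕ))).prod

theorem spinWedge_cons_plus {C : ℕ} (v : Fin C → Spin) :
    spinWedge R (Fin.cons .plus v : Fin (C + 1) → Spin) = spinWedge R v := by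
  simp [spinWedge, List.finRange_succ, List.filter_map, Function.comp_def]

theorem spinWedge_cons_minus {C : ℕ} (v : Fin C → Spin) :
    spinWedge R (Fin.cons .minus v : Fin (C + 1) → Spin) = ι R (X ^ C) * spinWedge R v := by
  simp [spinWedge, List.finRange_succ, List.filter_map, Function.comp_def]

theorem spinWedge_eq_ιMulti {n C : ℕ} (v : Fin C → Spin) {q : Fin n → Fin C} (hq : StrictMono q)
    (hv : ∀ j, v j = .minus ↔ ∃ k, q k = j) :
    spinWedge R v = ιMulti R n fun k => X ^ ((q k).rev : ℕ) := by
  have h_filter : (List.finRange C).filter (fun j => v j = .minus) = List.ofFn q :=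
    List.Pairwise.eq_of_mem_iff (r := (· < ·)) ((List.pairwise_lt_finRange C).filter _)
      (List.pairwise_ofFn.2 fun _ _ h => hq h) fun j => by simp [hv, List.mem_ofFn]
  rw [spinWedge, h_filter, ExteriorAlgebra.ιMulti_apply, List.map_ofFn]
  rfl

end SpinWedge

section Row

variable {C : ℕ} (w : SixVertexWeights R)

/-- The entries of the row transfer matrix: the partition function of a single row. -/
noncomputable def rowTransfer (left right : Spin) (top bottom : Fin C → Spin) : R :=
  ∑ h : Fin (C + 1) → Spin with h 0 = left ∧ h (Fin.last C) = right,
    ∏ j : Fin C, w.vertexWeight (h j.castSucc) (top j) (h j.succ) (bottom j)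

theorem rowTransfer_zero (left right : Spin) (top bottom : Fin 0 → Spin) :
    rowTransfer w left right top bottom = if left = right then 1 else 0 := by
  rw [rowTransfer, Finset.sum_filter, ← (Equiv.funUnique (Fin 1) Spin).symm.sum_comp,
    Spin.sum_univ]
  cases left <;> cases right <;> simp

theorem rowTransfer_cons (left right s t : Spin) (top bottom : Fin C → Spin) :
    rowTransfer w left right (Fin.cons s top : Fin (C + 1) → Spin) (Fin.cons t bottom) =
      ∑ r, w.vertexWeight left s r t * rowTransfer w r right top bottom := by
  simp only [rowTransfer, Finset.sum_filter, Finset.mul_sum]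
  rw [← (Fin.consEquiv fun _ : Fin (C + 2) => Spin).sum_comp, Fintype.sum_prod_type,
    Finset.sum_comm, Finset.sum_comm (s := Finset.univ (α := Spin))]
  refine Finset.sum_congr rfl fun h _ => ?_
  rw [Fintype.sum_eq_single left fun r hr => by simp [Fin.consEquiv, hr],
    Fintype.sum_eq_single (h 0) fun r hr => by simp [hr.symm]]
  simp [Fin.prod_univ_succ, Fin.consEquiv, ← Fin.succ_last]

/-- The image of the configuration `top` under the transfer matrix of a row with right boundary
spin `minus`, as an element of the exterior algebra. -/
noncomputable def rowState (left : Spin) (top : Fin C → Spin) :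
    ExteriorAlgebra R (Polynomial R) :=
  ∑ v : Fin C → Spin, rowTransfer w left .minus top v • spinWedge R v

theorem rowState_plus_zero (top : Fin 0 → Spin) : rowState w .plus top = 0 := by
  simp [rowState, rowTransfer_zero]

theorem rowState_minus_zero (top : Fin 0 → Spin) : rowState w .minus top = 1 := by
  simp [rowState, rowTransfer_zero, spinWedge]

theorem rowState_cons (left s : Spin) (top : Fin C → Spin) :
    rowState w left (Fin.cons s top : Fin (C + 1) → Spin) =
      ∑ r, (w.vertexWeight left s r .plus • rowState w r top +
        w.vertexWeight left s r .minus • (ι R (X ^ C) * rowState w r top)) := by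
  rw [rowState, ← (Fin.consEquiv fun _ : Fin (C + 1) => Spin).sum_comp, Fintype.sum_prod_type]
  simp only [Fin.consEquiv, Equiv.coe_fn_mk, rowTransfer_cons, spinWedge_cons_plus,
    spinWedge_cons_minus, Spin.sum_univ, rowState, Finset.smul_sum, Finset.mul_sum,
    ← Finset.sum_add_distrib, mul_smul_comm, smul_smul, add_smul]
  exact Finset.sum_congr rfl fun v _ => by abel

variable (top : Fin C → Spin)

theorem rowState_plus_cons_plus :
    rowState w .plus (Fin.cons .plus top : Fin (C + 1) → Spin) = w.a₁ • rowState w .plus top := by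
  simp [rowState_cons, Spin.sum_univ, SixVertexWeights.vertexWeight]

theorem rowState_minus_cons_plus :
    rowState w .minus (Fin.cons .plus top : Fin (C + 1) → Spin) =
      w.c₁ • (ι R (X ^ C) * rowState w .plus top) + w.b₂ • rowState w .minus top := by
  simp [rowState_cons, Spin.sum_univ, SixVertexWeights.vertexWeight]

theorem rowState_plus_cons_minus :
    rowState w .plus (Fin.cons .minus top : Fin (C + 1) → Spin) =
      w.b₁ • (ι R (X ^ C) * rowState w .plus top) + w.c₂ • rowState w .minus top := by
  simp [rowState_cons, Spin.sum_univ, SixVertexWeights.vertexWeight]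

theorem rowState_minus_cons_minus :
    rowState w .minus (Fin.cons .minus top : Fin (C + 1) → Spin) =
      w.a₂ • (ι R (X ^ C) * rowState w .minus top) := by
  simp [rowState_cons, Spin.sum_univ, SixVertexWeights.vertexWeight]

/-- The polynomial `a₂ + b₁ X`, through which the weights `a₂` and `b₁` of a row enter the
partition function. -/
noncomputable def rowPolynomial : Polynomial R :=
  Polynomial.C w.a₂ + Polynomial.C w.b₁ * X

theorem ι_rowPolynomial_mul_X_pow (n : ℕ) :
    ι R (rowPolynomial w * X ^ n) = w.a₂ • ι R (X ^ n) + w.b₁ • ι R (X ^ (n + 1)) := by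
  rw [← map_smul, ← map_smul, ← map_add, rowPolynomial]
  simp only [Polynomial.smul_eq_C_mul, pow_succ]
  ring_nf

variable {w}

theorem rowState_plus_cons_minus_cons_plus (hff : w.FreeFermionic) :
    rowState w .plus (Fin.cons .minus (Fin.cons .plus top : Fin (C + 1) → Spin) :
        Fin (C + 2) → Spin) =
      w.b₂ • rowState w .plus (Fin.cons .minus top : Fin (C + 1) → Spin) +
        w.a₁ • (ι R (rowPolynomial w * X ^ C) * rowState w .plus top) := by
  have h_c : w.c₂ * w.c₁ = w.a₁ * w.a₂ + w.b₂ * w.b₁ := by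
    rw [mul_comm, ← hff, mul_comm w.b₁]
  simp only [rowState_plus_cons_minus, rowState_minus_cons_plus, rowState_plus_cons_plus,
    ι_rowPolynomial_mul_X_pow, smul_add, add_mul, smul_mul_assoc, mul_smul_comm, smul_smul, h_c,
    add_smul, mul_comm w.b₁ w.a₁, mul_comm w.c₂ w.b₂]
  abel

theorem rowState_plus_cons_minus_cons_minus :
    rowState w .plus (Fin.cons .minus (Fin.cons .minus top : Fin (C + 1) → Spin) :
        Fin (C + 2) → Spin) =
      ι R (rowPolynomial w * X ^ C) *
        rowState w .plus (Fin.cons .minus top : Fin (C + 1) → Spin) := by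
  have h_X : ι R (X ^ C) * rowState w .plus (Fin.cons .minus top : Fin (C + 1) → Spin) =
      w.c₂ • (ι R (X ^ C) * rowState w .minus top) := by
    rw [rowState_plus_cons_minus, mul_add, mul_smul_comm, mul_smul_comm, ← mul_assoc,
      ExteriorAlgebra.ι_sq_zero, zero_mul, smul_zero, zero_add]
  rw [rowState_plus_cons_minus, rowState_minus_cons_minus, ι_rowPolynomial_mul_X_pow, add_mul,
    smul_mul_assoc, smul_mul_assoc, h_X, smul_comm w.c₂, add_comm]

theorem card_plus_cons_plus :
    Finset.card {j | (Fin.cons .plus top : Fin (C + 1) → Spin) j = .plus} =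
      Finset.card {j | top j = .plus} + 1 := by
  simp [Fin.card_filter_univ_succ]

theorem card_plus_cons_minus :
    Finset.card {j | (Fin.cons .minus top : Fin (C + 1) → Spin) j = .plus} =
      Finset.card {j | top j = .plus} := by
  simp [Fin.card_filter_univ_succ]

theorem mulMap_ι_rowPolynomial_mul_X_pow (x : R) (n : ℕ) :
    mulMap (Polynomial.C x - X) (ι R (rowPolynomial w * X ^ n)) =
      mulMap (rowPolynomial w) (x • ι R (X ^ n) - ι R (X ^ (n + 1))) := by
  rw [← map_smul (ι R), ← map_sub, mulMap_ι, mulMap_ι, Polynomial.smul_eq_C_mul]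
  ring_nf

theorem contractLeft_leval_ι_X_pow_mul (x : R) (n : ℕ) (y : ExteriorAlgebra R (Polynomial R)) :
    contractLeft (leval x) (ι R (X ^ n) * y) =
      x ^ n • y - ι R (X ^ n) * contractLeft (leval x) y := by
  rw [contractLeft_ι_mul]
  simp


theorem contractLeft_leval_ι_X_pow_succ_mul (x : R) (n : ℕ)
    (y : ExteriorAlgebra R (Polynomial R)) :
    contractLeft (leval x) (ι R (X ^ (n + 1)) * y) =
      x • contractLeft (leval x) (ι R (X ^ n) * y) +
        (x • ι R (X ^ n) - ι R (X ^ (n + 1))) * contractLeft (leval x) y := by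
  simp only [contractLeft_leval_ι_X_pow_mul, smul_sub, sub_mul, smul_mul_assoc, smul_smul,
    pow_succ' x]
  abel

theorem contractLeft_leval_ι_X_pow_succ_mul_ι_X_pow_mul (x : R) (n : ℕ)
    (y : ExteriorAlgebra R (Polynomial R)) :
    contractLeft (leval x) (ι R (X ^ (n + 1)) * (ι R (X ^ n) * y)) =
      (x • ι R (X ^ n) - ι R (X ^ (n + 1))) * contractLeft (leval x) (ι R (X ^ n) * y) := by
  rw [contractLeft_leval_ι_X_pow_succ_mul, ← mul_assoc (ι R (X ^ n)),
    ExteriorAlgebra.ι_sq_zero, zero_mul, map_zero, smul_zero, zero_add]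

theorem mulMap_rowState (hff : w.FreeFermionic) {x : R} (hx : w.b₂ = w.a₁ * x) :
    mulMap (Polynomial.C x - X) (rowState w .plus top) =
      (w.a₁ ^ Finset.card {j | top j = .plus} * w.c₂) •
        mulMap (rowPolynomial w) (contractLeft (leval x) (spinWedge R top)) := by
  let Row {n : ℕ} (v : Fin n → Spin) : Prop :=
    mulMap (Polynomial.C x - X) (rowState w .plus v) =
      (w.a₁ ^ Finset.card {j | v j = .plus} * w.c₂) •
        mulMap (rowPolynomial w) (contractLeft (leval x) (spinWedge R v))
  -- Free fermionicity trades row states with left spin `minus` for row states with left spin `plus`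
  -- and an extra `minus` column in front.
  suffices Row top ∧ Row (Fin.cons .minus top : Fin (C + 1) → Spin) from this.1
  induction top using Fin.consInduction with
  | elim0 =>
    refine ⟨?_, ?_⟩
    · simp [Row, rowState_plus_zero, spinWedge, contractLeft_one]
    · simp only [Row, rowState_plus_cons_minus, card_plus_cons_minus, spinWedge_cons_minus,
        contractLeft_leval_ι_X_pow_mul]
      simp [rowState_plus_zero, rowState_minus_zero, spinWedge, contractLeft_one]
  | @cons n s top ih =>
    obtain ⟨ih_top, ih_minus⟩ := ih
    simp only [Row, card_plus_cons_minus, spinWedge_cons_minus] at ih_top ih_minus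
    cases s with
    | plus =>
      simp only [Row, card_plus_cons_minus, card_plus_cons_plus, spinWedge_cons_minus,
        spinWedge_cons_plus]
      refine ⟨?_, ?_⟩
      · rw [rowState_plus_cons_plus, map_smul, ih_top, smul_smul, pow_succ', mul_assoc]
      · rw [rowState_plus_cons_minus_cons_plus top hff, map_add, map_smul, map_smul, map_mul,
          ih_top, ih_minus, mulMap_ι_rowPolynomial_mul_X_pow,
          contractLeft_leval_ι_X_pow_succ_mul, hx]
        simp only [map_add, map_mul, map_smul, mul_smul_comm]
        module
    | minus =>
      simp only [Row, card_plus_cons_minus, spinWedge_cons_minus]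
      refine ⟨ih_minus, ?_⟩
      rw [rowState_plus_cons_minus_cons_minus, map_mul, ih_minus,
        mulMap_ι_rowPolynomial_mul_X_pow, contractLeft_leval_ι_X_pow_succ_mul_ι_X_pow_mul,
        map_mul (mulMap _), mul_smul_comm]

end Row

namespace LatticeState

variable {N C : ℕ}

/-- The state obtained from `s` by adding a row with horizontal spins `h` and top spins `top`. -/
def addRow (s : LatticeState N C) (h : Fin (C + 1) → Spin) (top : Fin C → Spin) :
    LatticeState (N + 1) C :=
  (Fin.snoc s.1 h, Fin.snoc s.2 top)

theorem addRow_bijective :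
    Function.Bijective fun p : LatticeState N C × (Fin (C + 1) → Spin) × (Fin C → Spin) =>
      p.1.addRow p.2.1 p.2.2 := by
  constructor
  · rintro ⟨⟨s, s'⟩, h, t⟩ ⟨⟨u, u'⟩, k, l⟩ hp
    simp only [addRow, Prod.mk.injEq, Fin.snoc_inj] at hp ⊢
    tauto
  · rintro ⟨s, s'⟩
    exact ⟨⟨⟨Fin.init s, Fin.init s'⟩, s (Fin.last _), s' (Fin.last _)⟩, by simp [addRow]⟩

theorem addRow_hasBoundary (s : LatticeState N C) (h : Fin (C + 1) → Spin)
    (left right : Fin (N + 1) → Spin) (bottom top t : Fin C → Spin) :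
    (s.addRow h t).HasBoundary left right bottom top ↔
      (h 0 = left (Fin.last N) ∧ h (Fin.last C) = right (Fin.last N)) ∧ t = top ∧
        s.HasBoundary (Fin.init left) (Fin.init right) bottom (s.ver (Fin.last N)) := by
  have h_zero : (Fin.snoc s.2 t : Fin (N + 2) → Fin C → Spin) 0 = s.2 0 :=
    Fin.snoc_castSucc (α := fun _ => Fin C → Spin) t s.2 0
  simp only [HasBoundary, hor, ver, addRow, Fin.forall_fin_succ', Fin.snoc_castSucc, Fin.snoc_last,
    h_zero, funext_iff, Fin.init]
  tauto

theorem weight_addRow (w : Fin (N + 1) → SixVertexWeights R) (s : LatticeState N C)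
    (h : Fin (C + 1) → Spin) (t : Fin C → Spin) :
    (s.addRow h t).weight w = s.weight (Fin.init w) *
      ∏ j : Fin C, (w (Fin.last N)).vertexWeight (h j.castSucc) (t j) (h j.succ)
        (s.ver (Fin.last N) j) := by
  simp only [weight, hor, ver, addRow, Fin.prod_univ_castSucc, Fin.snoc_castSucc, Fin.snoc_last,
    Fin.succ_last, ← Fin.castSucc_succ, Fin.init]

end LatticeState

section PartitionFunction

variable {N C : ℕ}

theorem partitionFunction_zero_rows (w : Fin 0 → SixVertexWeights R) (left right : Fin 0 → Spin)
    (bottom top : Fin C → Spin) :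
    partitionFunction w left right bottom top = if top = bottom then 1 else 0 := by
  classical
  rw [partitionFunction, Finset.sum_filter,
    Fintype.sum_eq_single (⟨fun i => i.elim0, fun _ => top⟩ : LatticeState 0 C)]
  · simp [LatticeState.HasBoundary, LatticeState.weight, LatticeState.ver, funext_iff]
  · rintro ⟨s, s'⟩ hs
    refine if_neg fun h => hs (Prod.ext (funext fun i => i.elim0) (funext fun i => funext ?_))
    rw [Subsingleton.elim (α := Fin 1) i (Fin.last 0)]
    exact h.2.2.2

theorem partitionFunction_succ (w : Fin (N + 1) → SixVertexWeights R)
    (left right : Fin (N + 1) → Spin) (bottom top : Fin C → Spin) :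
    partitionFunction w left right bottom top =
      ∑ v, rowTransfer (w (Fin.last N)) (left (Fin.last N)) (right (Fin.last N)) top v *
        partitionFunction (Fin.init w) (Fin.init left) (Fin.init right) bottom v := by
  classical
  rw [partitionFunction, Finset.sum_filter,
    ← (Equiv.ofBijective _ LatticeState.addRow_bijective).sum_comp, Fintype.sum_prod_type]
  simp only [Equiv.ofBijective_apply, LatticeState.addRow_hasBoundary, LatticeState.weight_addRow,
    partitionFunction, Finset.sum_filter, Finset.mul_sum]
  rw [Finset.sum_comm (s := Finset.univ (α := Fin C → Spin))]
  refine Finset.sum_congr rfl fun s _ => ?_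
  rw [Fintype.sum_prod_type, Fintype.sum_eq_single (s.ver (Fin.last N))]
  · rw [rowTransfer, Finset.sum_filter, Finset.sum_mul]
    refine Finset.sum_congr rfl fun h _ => ?_
    rw [Fintype.sum_eq_single top fun t ht => if_neg fun h => ht h.2.1]
    simp only [true_and, ite_and, ite_mul, zero_mul, mul_ite, mul_zero]
    split_ifs <;> first | rfl | exact mul_comm _ _
  · intro v hv
    rw [if_neg fun h => hv (funext fun j => (h.2.2.2 j).symm), mul_zero]

theorem prod_prod_Iio_fin_succ {A : Type*} [CommMonoid A] (f : Fin (N + 1) → Fin (N + 1) → A) :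
    ∏ i, ∏ j ∈ Finset.Iio i, f i j =
      (∏ i : Fin N, ∏ j ∈ Finset.Iio i, f i.castSucc j.castSucc) *
        ∏ j : Fin N, f (Fin.last N) j.castSucc := by
  rw [Fin.prod_univ_castSucc, Fin.Iio_last_eq_map, Finset.prod_map]
  simp_rw [Fin.prod_Iio_castSucc]
  rfl

theorem wedgePairing_spinWedge_of_card_ne {n : ℕ} (d : Fin n → Module.Dual R (Polynomial R))
    {v : Fin C → Spin} (h : Finset.card {j | v j = .minus} ≠ n) :
    wedgePairing d (spinWedge R v) = 0 := by
  rw [spinWedge_eq_ιMulti v (Finset.orderEmbOfFin _ rfl).strictMono fun j => ?_]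
  · exact wedgePairing_ιMulti_of_ne h _ _
  · rw [← Set.mem_range, Finset.range_orderEmbOfFin]
    simp

theorem wedgePairing_zero_spinWedge (d : Fin 0 → Module.Dual R (Polynomial R))
    (v : Fin C → Spin) :
    wedgePairing d (spinWedge R v) = if v = fun _ => .plus then 1 else 0 := by
  split_ifs with h
  · have h_one : spinWedge R v = ιMulti R 0 Fin.elim0 := by
      simp [spinWedge, h, ExteriorAlgebra.ιMulti_zero_apply]
    rw [h_one, wedgePairing_ιMulti, Matrix.det_isEmpty]
  · refine wedgePairing_spinWedge_of_card_ne d fun h_card => h (funext fun j => ?_)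
    have h_minus : v j ≠ .minus := fun hj =>
      Finset.notMem_empty j (Finset.card_eq_zero.1 h_card ▸ Finset.mem_filter.2 ⟨by simp, hj⟩)
    cases hj : v j <;> simp_all

theorem card_plus_add_card_minus (v : Fin C → Spin) :
    Finset.card {j | v j = .plus} + Finset.card {j | v j = .minus} = C := by
  have h_not (j : Fin C) : v j = .minus ↔ ¬v j = .plus := by cases v j <;> simp
  simp only [h_not, Finset.card_filter_add_card_filter_not, Finset.card_univ, Fintype.card_fin]

theorem partitionFunction_succ_mul_eq_of_forall {n : ℕ} {w : Fin (N + 1) → SixVertexWeights R}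
    {left : Fin (N + 1) → Spin} {bottom : Fin C → Spin}
    {d : Fin n → Module.Dual R (Polynomial R)} {k l : R}
    (h : ∀ v, partitionFunction (Fin.init w) (Fin.init left) (fun _ => .minus) bottom v * k =
      l * wedgePairing d (spinWedge R v)) (top : Fin C → Spin) :
    partitionFunction w left (fun _ => .minus) bottom top * k =
      l * wedgePairing d (rowState (w (Fin.last N)) (left (Fin.last N)) top) := by
  simp only [partitionFunction_succ, Finset.sum_mul, rowState, map_sum, map_smul, smul_eq_mul,
    Finset.mul_sum]
  refine Finset.sum_congr rfl fun v _ => ?_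
  rw [mul_left_comm l, ← h, mul_assoc]
  rfl

theorem wedgePairing_rowState_mul_prod_sub {w : SixVertexWeights R} (hff : w.FreeFermionic)
    {x : Fin (N + 1) → R} (hx : w.b₂ = w.a₁ * x (Fin.last N)) (top : Fin C → Spin) :
    wedgePairing (fun i => leval (x i.castSucc)) (rowState w .plus top) *
        ∏ j : Fin N, (x j.castSucc - x (Fin.last N)) =
      w.a₁ ^ Finset.card {j | top j = .plus} * w.c₂ *
        (∏ j : Fin N, (rowPolynomial w).eval (x j.castSucc)) *
        wedgePairing (fun i => leval (x i)) (spinWedge R top) := by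
  have h_sign : ∏ j : Fin N, (x j.castSucc - x (Fin.last N)) =
      (-1) ^ N * ∏ j : Fin N, (x (Fin.last N) - x j.castSucc) := by
    simp_rw [← neg_sub (x (Fin.last N)), Finset.prod_neg, Finset.card_univ, Fintype.card_fin]
  have h_row := congrArg (wedgePairing fun i : Fin N => leval (x i.castSucc))
    (mulMap_rowState top hff hx)
  rw [map_smul, smul_eq_mul, wedgePairing_leval_mulMap, wedgePairing_leval_mulMap] at h_row
  simp only [Polynomial.eval_sub, Polynomial.eval_C, Polynomial.eval_X] at h_row
  rw [wedgePairing_succ, h_sign, mul_left_comm, mul_comm (wedgePairing _ _), h_row]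
  simp only [Fin.init_def]
  ring

theorem prod_pow_sub_mul_prod_mul_pow_card {w : Fin (N + 1) → SixVertexWeights R}
    {x : Fin (N + 1) → R} (hx : ∀ i, (w i).b₂ = (w i).a₁ * x i) {top : Fin C → Spin}
    (h_card : Finset.card {j | top j = .minus} = N + 1) :
    (∏ i : Fin N, (w i.castSucc).a₁ ^ (C - N) * (w i.castSucc).c₂) *
        ((w (Fin.last N)).a₁ ^ Finset.card {j | top j = .plus} * (w (Fin.last N)).c₂ *
          ∏ j : Fin N, (rowPolynomial (w (Fin.last N))).eval (x j.castSucc)) =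
      (∏ i, (w i).a₁ ^ (C - (N + 1)) * (w i).c₂) *
        ∏ j : Fin N, ((w j.castSucc).a₁ * (w (Fin.last N)).a₂ +
          (w (Fin.last N)).b₁ * (w j.castSucc).b₂) := by
  have h_plus := card_plus_add_card_minus top
  have h_eval (j : Fin N) :
      (w j.castSucc).a₁ * (w (Fin.last N)).a₂ + (w (Fin.last N)).b₁ * (w j.castSucc).b₂ =
        (w j.castSucc).a₁ * (rowPolynomial (w (Fin.last N))).eval (x j.castSucc) := by
    simp only [hx, rowPolynomial, Polynomial.eval_add, Polynomial.eval_mul, Polynomial.eval_C,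
      Polynomial.eval_X]
    ring
  rw [h_card] at h_plus
  have h_sub : C - N = Finset.card {j | top j = .plus} + 1 := by omega
  have h_sub' : C - (N + 1) = Finset.card {j | top j = .plus} := by omega
  simp only [h_eval, Fin.prod_univ_castSucc, h_sub, h_sub', pow_succ, Finset.prod_mul_distrib]
  ring

theorem partitionFunction_mul_prod_sub (w : Fin N → SixVertexWeights R)
    (hff : ∀ i, (w i).FreeFermionic) {x : Fin N → R} (hx : ∀ i, (w i).b₂ = (w i).a₁ * x i)
    (top : Fin C → Spin) :
    partitionFunction w (fun _ => .plus) (fun _ => .minus) (fun _ => .plus) top *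
        ∏ i, ∏ j ∈ Finset.Iio i, (x j - x i) =
      (∏ i, (w i).a₁ ^ (C - N) * (w i).c₂) *
        (∏ i, ∏ j ∈ Finset.Iio i, ((w j).a₁ * (w i).a₂ + (w i).b₁ * (w j).b₂)) *
        wedgePairing (fun i => leval (x i)) (spinWedge R top) := by
  induction N generalizing top with
  | zero => simp [partitionFunction_zero_rows, wedgePairing_zero_spinWedge]
  | succ N ih =>
    have h_rows := partitionFunction_succ_mul_eq_of_forall (w := w) (left := fun _ => .plus)
      (ih (Fin.init w) (fun i => hff i.castSucc) (x := Fin.init x) fun i => hx i.castSucc) top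
    simp only [Fin.init_def] at h_rows
    rw [prod_prod_Iio_fin_succ fun i j => x j - x i, ← mul_assoc, h_rows, mul_assoc,
      wedgePairing_rowState_mul_prod_sub (hff _) (hx _)]
    by_cases h_card : Finset.card {j | top j = .minus} = N + 1
    · have h_factors := prod_pow_sub_mul_prod_mul_pow_card hx h_card
      rw [prod_prod_Iio_fin_succ fun i j => (w j).a₁ * (w i).a₂ + (w i).b₁ * (w j).b₂]
      linear_combination (∏ i : Fin N, ∏ j ∈ Finset.Iio i,
        ((w j.castSucc).a₁ * (w i.castSucc).a₂ + (w i.castSucc).b₁ * (w j.castSucc).b₂)) *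
          wedgePairing (fun i => leval (x i)) (spinWedge R top) * h_factors
    · simp only [wedgePairing_spinWedge_of_card_ne _ h_card, mul_zero]

end PartitionFunction

section Schur

variable {N M : ℕ} {lam : Fin N → ℕ}

theorem aeval_alternant (x : Fin N → R) (m : Fin N → ℕ) :
    MvPolynomial.aeval x (alternant m) = (Matrix.of fun i j => x i ^ m j).det := by
  rw [alternant, AlgHom.map_det]
  congr 1
  ext i j
  simp

theorem aeval_alternant_rho (x : Fin N → R) :
    MvPolynomial.aeval x (alternant (shiftRho fun _ : Fin N => 0)) =
      ∏ i, ∏ j ∈ Finset.Iio i, (x j - x i) := by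
  have h_vandermonde : (Matrix.of fun i j => x i ^ shiftRho (fun _ : Fin N => 0) j) =
      Matrix.projVandermonde (fun _ => 1) x := by
    ext i j
    simp [shiftRho, Matrix.projVandermonde_apply]
  rw [aeval_alternant, h_vandermonde, Matrix.det_projVandermonde,
    Finset.prod_comm' (t' := Finset.univ) (s' := Finset.Iio) (by simp)]
  simp

theorem shiftRho_strictAnti (hlam : Antitone lam) : StrictAnti (shiftRho lam) := fun _ _ h =>
  add_lt_add_of_le_of_lt (hlam h.le) (Fin.rev_lt_rev.2 h)

theorem shiftRho_boxComplement (hlam : Antitone lam) (hM : ∀ k, shiftRho lam k ≤ M) (k : Fin N) :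
    shiftRho (boxComplement (M + 1 - N) lam) k = M - shiftRho lam k.rev := by
  have : NeZero N := ⟨k.pos.ne'⟩
  have h_zero := hM 0
  have h_le : lam k.rev ≤ lam 0 := hlam (Fin.zero_le _)
  simp only [shiftRho, boxComplement, Fin.val_rev, Fin.rev_rev, Fin.val_zero] at *
  omega

theorem boundarySpin_eq_minus_iff {C : ℕ} {p : Fin N → ℕ} {j : Fin C} :
    boundarySpin p j = .minus ↔ ∃ k, p k = (j : ℕ) := by
  rw [boundarySpin]
  split_ifs with h <;> simp [h]

theorem wedgePairing_spinWedge_boundarySpin (hlam : Antitone lam) (hM : ∀ k, shiftRho lam k ≤ M)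
    (x : Fin N → R) :
    wedgePairing (fun i => leval (x i))
        (spinWedge R (boundarySpin (shiftRho lam) : Fin (M + 1) → Spin)) =
      MvPolynomial.aeval x (alternant (shiftRho (boxComplement (M + 1 - N) lam))) := by
  have h_mono : StrictMono fun k : Fin N =>
      (⟨shiftRho lam k.rev, Nat.lt_succ_of_le (hM _)⟩ : Fin (M + 1)) :=
    fun _ _ h => shiftRho_strictAnti hlam (Fin.rev_lt_rev.2 h)
  rw [spinWedge_eq_ιMulti _ h_mono fun j => ?_, wedgePairing_ιMulti, aeval_alternant]
  · congr 1
    ext i j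
    simp [shiftRho_boxComplement hlam hM]
  · rw [boundarySpin_eq_minus_iff, ← Fin.revPerm.exists_congr_right]
    simp [Fin.ext_iff]

theorem domainWallZ_eq_of_isRegular (w : Fin N → SixVertexWeights R)
    (hff : ∀ i, (w i).FreeFermionic) {x : Fin N → R} (hx : ∀ i, (w i).b₂ = (w i).a₁ * x i)
    (h_reg : IsRegular (∏ i, ∏ j ∈ Finset.Iio i, (x j - x i))) (hlam : Antitone lam)
    (hM : ∀ k, shiftRho lam k ≤ M) :
    domainWallZ M w lam =
      (∏ i, (w i).a₁ ^ (M + 1 - N) * (w i).c₂) *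
      (∏ i, ∏ j ∈ Finset.Iio i, ((w j).a₁ * (w i).a₂ + (w i).b₁ * (w j).b₂)) *
      MvPolynomial.aeval x (schurPoly (boxComplement (M + 1 - N) lam)) := by
  have h_mul := partitionFunction_mul_prod_sub w hff hx
    (boundarySpin (shiftRho lam) : Fin (M + 1) → Spin)
  rw [wedgePairing_spinWedge_boundarySpin hlam hM, ← alternant_rho_mul_schurPoly, map_mul,
    aeval_alternant_rho] at h_mul
  exact h_reg.right (h_mul.trans (by ring))

end Schur

section BaseChange

variable {S : Type*} [CommRing S]

namespace SixVertexWeights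

/-- The image of the weights under a ring homomorphism. -/
def map (f : R →+* S) (w : SixVertexWeights R) : SixVertexWeights S :=
  ⟨f w.a₁, f w.a₂, f w.b₁, f w.b₂, f w.c₁, f w.c₂⟩

theorem vertexWeight_map (f : R →+* S) (w : SixVertexWeights R) (l t r b : Spin) :
    (w.map f).vertexWeight l t r b = f (w.vertexWeight l t r b) := by
  cases l <;> cases t <;> cases r <;> cases b <;> simp [vertexWeight, map]

/-- The deformation of the weights that shifts `b₂ / a₁` by `t`; the shift of `a₂` preserves the
free fermion condition. -/
def deform (w : SixVertexWeights R) (t : R) : SixVertexWeights R :=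
  ⟨w.a₁, w.a₂ - w.b₁ * t, w.b₁, w.b₂ + w.a₁ * t, w.c₁, w.c₂⟩

theorem FreeFermionic.map {w : SixVertexWeights R} (h : w.FreeFermionic) (f : R →+* S) :
    (w.map f).FreeFermionic := by
  simp only [FreeFermionic, SixVertexWeights.map, ← map_mul, ← map_add] at h ⊢
  rw [h]

theorem FreeFermionic.deform {w : SixVertexWeights R} (h : w.FreeFermionic) (t : R) :
    (w.deform t).FreeFermionic := by
  simp only [FreeFermionic, SixVertexWeights.deform] at h ⊢
  linear_combination h

end SixVertexWeights

theorem domainWallZ_map (f : R →+* S) {N : ℕ} (M : ℕ) (w : Fin N → SixVertexWeights R)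
    (lam : Fin N → ℕ) :
    domainWallZ M (fun i => (w i).map f) lam = f (domainWallZ M w lam) := by
  simp [domainWallZ, partitionFunction, LatticeState.weight, SixVertexWeights.vertexWeight_map]

theorem map_ringHom_aeval {σ : Type*} (f : R →+* S) (x : σ → R) (P : MvPolynomial σ ℤ) :
    f (MvPolynomial.aeval x P) = MvPolynomial.aeval (fun i => f (x i)) P :=
  MvPolynomial.comp_aeval_apply (f := x) f.toIntAlgHom P

end BaseChange

theorem isRegular_prod_C_add_X_pow_sub {N : ℕ} (x : Fin N → R) :
    IsRegular (∏ i, ∏ j ∈ Finset.Iio i,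
      ((Polynomial.C (x j) + X ^ (j + 1 : ℕ)) - (Polynomial.C (x i) + X ^ (i + 1 : ℕ)))) := by
  refine IsRegular.prod fun i _ => IsRegular.prod fun j hj => ?_
  have h_lt : (j + 1 : ℕ) < i + 1 := Nat.succ_lt_succ (Fin.lt_def.1 (Finset.mem_Iio.1 hj))
  have h_monic : (X ^ (i + 1 : ℕ) + (Polynomial.C (x i - x j) - X ^ (j + 1 : ℕ))).Monic :=
    Polynomial.monic_X_pow_add <| (Polynomial.degree_sub_le _ _).trans_lt <| max_lt
      (Polynomial.degree_C_le.trans_lt (mod_cast Nat.succ_pos i))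
      ((Polynomial.degree_X_pow_le _).trans_lt (mod_cast h_lt))
  have h_neg : (Polynomial.C (x j) + X ^ (j + 1 : ℕ)) - (Polynomial.C (x i) + X ^ (i + 1 : ℕ)) =
      -1 * (X ^ (i + 1 : ℕ) + (Polynomial.C (x i - x j) - X ^ (j + 1 : ℕ))) := by
    rw [map_sub]
    ring
  exact h_neg ▸ isUnit_one.neg.isRegular.mul h_monic.isRegular

theorem mainTheorem8_general {N M : ℕ} (w : Fin N → SixVertexWeights R)
    (hff : ∀ i, (w i).FreeFermionic) {x : Fin N → R} (hx : ∀ i, (w i).b₂ = (w i).a₁ * x i)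
    {lam : Fin N → ℕ} (hlam : Antitone lam) (hM : ∀ k, shiftRho lam k ≤ M) :
    domainWallZ M w lam =
      (∏ i, (w i).a₁ ^ (M + 1 - N) * (w i).c₂) *
      (∏ i, ∏ j ∈ Finset.Iio i, ((w j).a₁ * (w i).a₂ + (w i).b₁ * (w j).b₂)) *
      MvPolynomial.aeval x (schurPoly (boxComplement (M + 1 - N) lam)) := by
  let W (i : Fin N) : SixVertexWeights (Polynomial R) :=
    ((w i).map Polynomial.C).deform (X ^ (i + 1 : ℕ))
  let f : Polynomial R →+* R := Polynomial.evalRingHom 0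
  have hW (i : Fin N) : (W i).b₂ = (W i).a₁ * (Polynomial.C (x i) + X ^ (i + 1 : ℕ)) := by
    simp [W, SixVertexWeights.deform, SixVertexWeights.map, hx, mul_add]
  have h_map : (fun i => (W i).map f) = w := by
    funext i
    simp [W, f, SixVertexWeights.deform, SixVertexWeights.map]
  have h_poly := congrArg f (domainWallZ_eq_of_isRegular W (fun i => ((hff i).map _).deform _) hW
    (isRegular_prod_C_add_X_pow_sub x) hlam hM)
  rw [← domainWallZ_map, h_map] at h_poly
  simp only [map_mul, map_prod, map_pow, map_add, map_ringHom_aeval] at h_poly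
  simpa [W, f, SixVertexWeights.deform, SixVertexWeights.map] using h_poly

end FreeFermion

theorem mainTheorem8 {K : Type*} [Field K] (N M : ℕ) (w : Fin N → SixVertexWeights K)
    (hff : ∀ i, (w i).FreeFermionic) (ha : ∀ i, (w i).a₁ ≠ 0)
    (lam : Fin N → ℕ) (hlam : Antitone lam) (hM : ∀ k, shiftRho lam k ≤ M) :
    domainWallZ M w lam =
      (∏ i, (w i).a₁ ^ (M + 1 - N) * (w i).c₂) *
      (∏ i, ∏ j ∈ Finset.Iio i, ((w j).a₁ * (w i).a₂ + (w i).b₁ * (w j).b₂)) *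
      MvPolynomial.aeval (fun i => (w i).b₂ / (w i).a₁)
        (schurPoly (boxComplement (M + 1 - N) lam)) :=
  mainTheorem8_general w hff (fun i => (mul_div_cancel₀ _ (ha i)).symm) hlam hM
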